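/- For a positive integer $\ell$ and an integer $n\ge 0$, let $M_\ell(n)$ denote the maximum size of a family $\mathcal F$ of Hamiltonian paths of the complete graph $K_n$ (regarded as unoriented paths, i.e. as graphs on the vertex set of $K_n$) such that for any two distinct $H_1,H_2\in\mathcal F$ the union $H_1\cup H_2$ (the graph on the same vertex set with edge set $E(H_1)\cup E(H_2)$) contains a cycle of length $2^\ell+1$. Then for every fixed positive integer $\ell$, $$M_\ell(n)=2^{\,n-o(n)}\qquad (n\to\infty),$$ that is, $M_\ell(n)=2^{\,n-\varepsilon_\ell(n)}$ for some real-valued function $\varepsilon_\ell$ with $\varepsilon_\ell(n)/n\to 0$ as $n\to\infty$. -/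

import Mathlib

open Filter Asymptotics

/-- `H` is (the edge set of) a Hamiltonian path of the complete graph on `Fin n`: a graph on all of
the vertices `Fin n` that is a path on `n` vertices. Paths are unoriented, that is, a path and its
reversal are the same graph. -/
def IsHamPath {n : ℕ} (H : SimpleGraph (Fin n)) : Prop :=
  Nonempty (SimpleGraph.pathGraph n ≃g H)

/-- `G` contains a cycle of length `k`, as a not necessarily induced subgraph. -/
def ContainsCycle {V : Type*} (G : SimpleGraph V) (k : ℕ) : Prop :=
  ∃ (v : V) (c : G.Walk v v), c.IsCycle ∧ c.length = k

/-- `F` is a family of Hamiltonian paths of the complete graph on `Fin n` such that the union of any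
two different members of `F` contains a cycle of length `k`. -/
def IsCycleDifferentFamily (n k : ℕ) (F : Finset (SimpleGraph (Fin n))) : Prop :=
  (∀ H ∈ F, IsHamPath H) ∧
    ∀ H₁ ∈ F, ∀ H₂ ∈ F, H₁ ≠ H₂ → ContainsCycle (H₁ ⊔ H₂) k

/-! Upper bound: paths are bipartite, and two paths with a common proper 2-colouring have a
bipartite union, which has no odd cycle. So there are at most `2 ^ n` paths.

Lower bound: if an edge of one path joins points at distance `2 ^ ℓ` on the other, it closes a cycle
of length `2 ^ ℓ + 1`. Families with such witnesses are built by induction on `ℓ`, starting from the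
colourings of one fixed order (`natural`). The step `combine` takes `2 * s` pairs of points and
chooses `s` of them. The chosen pairs carry a family of level `ℓ`, each pair being adjacent
(`split`, which doubles distances); the others carry a family of level `ℓ + 1`, the two points of a
pair being `2 ^ (ℓ + 1)` apart (`blow`). Two different choices are separated by a pair chosen in
only one of them. If `g` and `h` are the sizes of the two families, then `4 * s` points carry
`s.centralBinom * g * h` members, and the logarithms add up to about `2 * s + s + s`.

The colours in `IsWitness` make `split` preserve witnesses; the block condition does so for `blow`.
-/

/-- The points `u`, `v` are consecutive for `p`, at distance `2 ^ ℓ` for `q`, and have different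
relative colours for `c` and `d`. Moreover, if blocks of `2 ^ ℓ` consecutive positions are formed,
then `u`, `v` are in one block for `p`, or they are separated by the same block border for `p`
and `q`. -/
def IsWitness {V : Type*} (ℓ : ℕ) (p q : V → ℕ) (c d : V → Bool) (u v : V) : Prop :=
  p v = p u + 1 ∧ (q v = q u + 2 ^ ℓ ∨ q u = q v + 2 ^ ℓ) ∧
    (c u ^^ c v) = !(d u ^^ d v) ∧
    (p u / 2 ^ ℓ = p v / 2 ^ ℓ ∨ min (q u) (q v) / 2 ^ ℓ = p u / 2 ^ ℓ)

/-- A family, indexed by `I`, of orderings and `2`-colourings of `V`, any two of which are told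
apart by a pair of points as in `IsWitness`. -/
structure SepFamily (ℓ : ℕ) (V I : Type*) [Fintype V] where
  pos : I → V → ℕ
  col : I → V → Bool
  inj : ∀ f, Function.Injective (pos f)
  lt : ∀ f v, pos f v < Fintype.card V
  sep : ∀ f g, f ≠ g → (∃ u v, IsWitness ℓ (pos f) (pos g) (col f) (col g) u v) ∨
    ∃ u v, IsWitness ℓ (pos g) (pos f) (col g) (col f) u v

/-! ### Separating families: base case, padding and splitting -/

namespace SepFamily

variable {ℓ : ℕ} {V W I J : Type*} [Fintype V] [Fintype W]

/-- Transport of a family along bijections. -/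
def transport (F : SepFamily ℓ V I) (e : W ≃ V) (i : J ≃ I) : SepFamily ℓ W J where
  pos f w := F.pos (i f) (e w)
  col f w := F.col (i f) (e w)
  inj f := (F.inj _).comp e.injective
  lt f w := by rw [Fintype.card_congr e]; exact F.lt _ _
  sep f g h := by
    have key : ∀ f g, (∃ u v, IsWitness ℓ (F.pos f) (F.pos g) (F.col f) (F.col g) u v) →
        ∃ u v, IsWitness ℓ (fun w => F.pos f (e w)) (fun w => F.pos g (e w))
          (fun w => F.col f (e w)) (fun w => F.col g (e w)) u v := by
      rintro f g ⟨u, v, h⟩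
      exact ⟨e.symm u, e.symm v, by simpa [IsWitness] using h⟩
    exact (F.sep _ _ (i.injective.ne h)).imp (key _ _) (key _ _)

/-- A last point is added. -/
def pad (F : SepFamily ℓ V I) : SepFamily ℓ (Option V) I where
  pos f w := w.elim (Fintype.card V) (F.pos f)
  col f w := w.elim false (F.col f)
  inj f := by
    have h := F.lt f
    rintro (_ | u) (_ | v) huv
    · rfl
    · exact absurd huv (h v).ne'
    · exact absurd huv (h u).ne
    · exact congrArg some (F.inj f huv)
  lt f w := by
    rw [Fintype.card_option]
    cases w with
    | none => simp
    | some v => exact (F.lt f v).trans (Nat.lt_succ_self _)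
  sep f g h := (F.sep f g h).imp (fun ⟨u, v, h⟩ => ⟨some u, some v, h⟩)
    (fun ⟨u, v, h⟩ => ⟨some u, some v, h⟩)

/-- The natural order with all colourings for which the first point has colour `false`. -/
def natural (n : ℕ) : SepFamily 0 (Fin (n + 1)) (Fin n → Bool) where
  pos _ v := v
  col f := Fin.cons false f
  inj _ := Fin.val_injective
  lt _ v := by rw [Fintype.card_fin]; exact v.2
  sep f g h := by
    left
    obtain ⟨k, hk⟩ := Function.ne_iff.1 h
    classical
    -- At the first difference the preceding colours still agree, so the relative colour changes
    -- there; the fixed colour of the first point starts this off.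
    have hex : ∃ m : ℕ, ∃ hm : m < n, f ⟨m, hm⟩ ≠ g ⟨m, hm⟩ := ⟨k, k.2, hk⟩
    obtain ⟨hm, hne⟩ := Nat.find_spec hex
    have hmin := fun j => @Nat.find_min _ _ hex j
    set m := Nat.find hex
    have hpre : (Fin.cons false f : Fin (n + 1) → Bool) (Fin.castSucc ⟨m, hm⟩) =
        (Fin.cons false g : Fin (n + 1) → Bool) (Fin.castSucc ⟨m, hm⟩) := by
      rcases Nat.eq_zero_or_pos m with h0 | h0
      · have : Fin.castSucc (⟨m, hm⟩ : Fin n) = 0 := Fin.ext (by simpa using h0)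
        rw [this]; rfl
      · have : Fin.castSucc (⟨m, hm⟩ : Fin n) = Fin.succ ⟨m - 1, by omega⟩ :=
          Fin.ext (by simp; omega)
        rw [this, Fin.cons_succ, Fin.cons_succ]
        by_contra hcon
        exact hmin (m - 1) (by omega) ⟨by omega, hcon⟩
    refine ⟨Fin.castSucc ⟨m, hm⟩, Fin.succ ⟨m, hm⟩, by simp, by simp, ?_, by simp⟩
    rw [hpre, Fin.cons_succ, Fin.cons_succ]
    revert hne
    cases f ⟨m, hm⟩ <;> cases g ⟨m, hm⟩ <;> simp

/-- The family with one member. -/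
def single (ℓ n : ℕ) : SepFamily ℓ (Fin n) Unit where
  pos _ v := v
  col _ _ := false
  inj _ := Fin.val_injective
  lt _ v := by simp
  sep f g h := absurd rfl h

theorem two_mul_add_div (ℓ a : ℕ) (b : Bool) :
    (2 * a + b.toNat) / 2 ^ (ℓ + 1) = a / 2 ^ ℓ := by
  rw [pow_succ', ← Nat.div_div_eq_div_mul]
  congr 1
  have := Bool.toNat_le b
  omega

/-- Each point becomes two consecutive points of different colours, the one of colour `false`
being the first. -/
def split (F : SepFamily ℓ V I) : SepFamily (ℓ + 1) (V × Bool) I where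
  pos f w := 2 * F.pos f w.1 + (F.col f w.1 ^^ w.2).toNat
  col f w := F.col f w.1 ^^ w.2
  inj f := by
    rintro ⟨u, a⟩ ⟨v, b⟩ h
    have h1 := Bool.toNat_le (F.col f u ^^ a)
    have h2 := Bool.toNat_le (F.col f v ^^ b)
    simp only at h
    obtain rfl : u = v := F.inj f (by omega)
    have : (F.col f u ^^ a).toNat = (F.col f u ^^ b).toNat := by omega
    revert this
    cases F.col f u <;> cases a <;> cases b <;> simp
  lt f w := by
    have h1 := Bool.toNat_le (F.col f w.1 ^^ w.2)
    have h2 := F.lt f w.1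
    simp only [Fintype.card_prod, Fintype.card_bool]
    omega
  sep f g h := by
    have key : ∀ f g, (∃ u v, IsWitness ℓ (F.pos f) (F.pos g) (F.col f) (F.col g) u v) →
        ∃ u v, IsWitness (ℓ + 1) (fun w : V × Bool => 2 * F.pos f w.1 + (F.col f w.1 ^^ w.2).toNat)
          (fun w => 2 * F.pos g w.1 + (F.col g w.1 ^^ w.2).toNat)
          (fun w => F.col f w.1 ^^ w.2) (fun w => F.col g w.1 ^^ w.2) u v := by
      rintro f g ⟨u, v, h1, h2, h3, h4⟩
      have he : (F.col g v ^^ F.col f v) = (F.col g u ^^ !F.col f u) := by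
        revert h3
        cases F.col f u <;> cases F.col f v <;> cases F.col g u <;> cases F.col g v <;> simp
      -- For `f` these are the second copy of `u` and the first copy of `v`, hence adjacent. By `he`
      -- both have the same offset for `g`, so the distance exactly doubles.
      refine ⟨(u, !F.col f u), (v, F.col f v), ?_, ?_, ?_, ?_⟩
      · simp [h1]; ring
      · simp only [he, pow_succ]
        omega
      · simp only [he]
        simp
      · simp only [two_mul_add_div, he]
        have hmin : ∀ a b c : ℕ, min (2 * a + c) (2 * b + c) = 2 * min a b + c := by omega
        rw [hmin, two_mul_add_div]
        exact h4
    exact (F.sep _ _ h).imp (key _ _) (key _ _)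

end SepFamily

/-! ### Blowing up blocks -/

namespace SepFamily

variable {ℓ : ℕ} {V W I J : Type*} [Fintype V] [Fintype W]

/-- Positions in the arrangement in which each block of `2 ^ ℓ` points is replaced by two copies,
one after the other; the copy labelled `true` comes first in every other block. -/
def blowPos (ℓ q : ℕ) (b : Bool) : ℕ :=
  (2 * (q / 2 ^ ℓ) + (b ^^ (q / 2 ^ ℓ).bodd).toNat) * 2 ^ ℓ + q % 2 ^ ℓ

theorem blowPos_div (ℓ q : ℕ) (b : Bool) :
    blowPos ℓ q b / 2 ^ ℓ = 2 * (q / 2 ^ ℓ) + (b ^^ (q / 2 ^ ℓ).bodd).toNat := by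
  have h := Nat.two_pow_pos ℓ
  rw [blowPos, add_comm, Nat.add_mul_div_right _ _ h, Nat.div_eq_of_lt (Nat.mod_lt _ h), zero_add]

theorem blowPos_mod (ℓ q : ℕ) (b : Bool) : blowPos ℓ q b % 2 ^ ℓ = q % 2 ^ ℓ := by
  rw [blowPos, Nat.mul_add_mod_self_right, Nat.mod_mod]

theorem blowPos_inj {ℓ q r : ℕ} {a b : Bool} (h : blowPos ℓ q a = blowPos ℓ r b) :
    q = r ∧ a = b := by
  have h1 := congrArg (· / 2 ^ ℓ) h
  have h2 := congrArg (· % 2 ^ ℓ) h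
  simp only [blowPos_div, blowPos_mod] at h1 h2
  have ha := Bool.toNat_le (a ^^ (q / 2 ^ ℓ).bodd)
  have hb := Bool.toNat_le (b ^^ (r / 2 ^ ℓ).bodd)
  have h3 : q / 2 ^ ℓ = r / 2 ^ ℓ := by omega
  rw [h3] at h1
  refine ⟨by rw [← Nat.div_add_mod q (2 ^ ℓ), h2, h3, Nat.div_add_mod], ?_⟩
  have h4 : (a ^^ (r / 2 ^ ℓ).bodd).toNat = (b ^^ (r / 2 ^ ℓ).bodd).toNat := by omega
  revert h4
  cases a <;> cases b <;> cases (r / 2 ^ ℓ).bodd <;> simp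

theorem blowPos_lt {ℓ q n : ℕ} (hn : 2 ^ ℓ ∣ n) (hq : q < n) (b : Bool) :
    blowPos ℓ q b < n * 2 := by
  obtain ⟨t, rfl⟩ := hn
  have h := Nat.two_pow_pos ℓ
  have h1 : q / 2 ^ ℓ < t := Nat.div_lt_of_lt_mul hq
  have h2 : blowPos ℓ q b / 2 ^ ℓ < 2 * t := by
    rw [blowPos_div]
    have := Bool.toNat_le (b ^^ (q / 2 ^ ℓ).bodd)
    omega
  rw [Nat.div_lt_iff_lt_mul h] at h2
  linarith

theorem blowPos_true_false (ℓ q : ℕ) : blowPos ℓ q true = blowPos ℓ q false + 2 ^ ℓ ∨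
    blowPos ℓ q false = blowPos ℓ q true + 2 ^ ℓ := by
  unfold blowPos
  cases (q / 2 ^ ℓ).bodd <;> simp <;> [left; right] <;> ring

/-- The labels of the new blocks run false, true, true, false, false, true, ..., so at each old
border the two blocks that meet have the same label, determined by the parity of the border. Copies
with this label keep their distance across the border. -/
theorem blowPos_add (ℓ q : ℕ) :
    blowPos ℓ (q + 2 ^ ℓ) (!(q / 2 ^ ℓ).bodd) = blowPos ℓ q (!(q / 2 ^ ℓ).bodd) + 2 ^ ℓ ∧
      blowPos ℓ q (!(q / 2 ^ ℓ).bodd) / 2 ^ ℓ = 2 * (q / 2 ^ ℓ) + 1 := by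
  have h := Nat.two_pow_pos ℓ
  constructor
  · unfold blowPos
    rw [Nat.add_div_right _ h, Nat.add_mod_right, Nat.bodd_succ]
    cases (q / 2 ^ ℓ).bodd <;> simp <;> ring
  · rw [blowPos_div]
    cases (q / 2 ^ ℓ).bodd <;> simp

theorem blowPos_succ_of_div_eq {ℓ q : ℕ} (h : q / 2 ^ ℓ = (q + 1) / 2 ^ ℓ) (b : Bool) :
    blowPos ℓ (q + 1) b = blowPos ℓ q b + 1 := by
  have h1 := Nat.div_add_mod q (2 ^ ℓ)
  have h2 := Nat.div_add_mod (q + 1) (2 ^ ℓ)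
  rw [← h] at h2
  unfold blowPos
  rw [← h]
  omega

theorem blowPos_succ_of_div_ne {ℓ q : ℕ} (h : q / 2 ^ ℓ ≠ (q + 1) / 2 ^ ℓ) :
    blowPos ℓ (q + 1) (!(q / 2 ^ ℓ).bodd) = blowPos ℓ q (!(q / 2 ^ ℓ).bodd) + 1 := by
  have hp := Nat.two_pow_pos ℓ
  have hd : 2 ^ ℓ ∣ q + 1 := by
    by_contra hd
    exact h (Nat.succ_div_of_not_dvd hd).symm
  have h3 := Nat.succ_div_of_dvd hd
  have h1 := Nat.div_add_mod q (2 ^ ℓ)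
  have h2 := Nat.div_add_mod (q + 1) (2 ^ ℓ)
  have h4 := Nat.mod_eq_zero_of_dvd hd
  rw [h3, mul_add, mul_one, h4] at h2
  unfold blowPos
  rw [h3, h4, Nat.bodd_succ]
  cases (q / 2 ^ ℓ).bodd <;> simp <;> linarith

/-- The label is dictated by the border that `u` and `v` straddle for `q`. It also suits `p`: within
a block any label works, and otherwise the block condition says that the border is the same. -/
theorem IsWitness.blow {V : Type*} {p q : V → ℕ} {c d : V → Bool} {u v : V} (h : IsWitness ℓ p q c d u v) :
    ∃ b, IsWitness ℓ (fun w : V × Bool => blowPos ℓ (p w.1) w.2)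
      (fun w => blowPos ℓ (q w.1) w.2) (fun w => c w.1) (fun w => d w.1) (u, b) (v, b) := by
  obtain ⟨h1, h2, h3, h4⟩ := h
  have hm : q u = min (q u) (q v) ∧ q v = min (q u) (q v) + 2 ^ ℓ ∨
      q v = min (q u) (q v) ∧ q u = min (q u) (q v) + 2 ^ ℓ := by
    have := Nat.two_pow_pos ℓ
    omega
  generalize min (q u) (q v) = m at *
  obtain ⟨ha, hb⟩ := blowPos_add ℓ m
  have hq : (blowPos ℓ (q v) (!(m / 2 ^ ℓ).bodd) =
        blowPos ℓ (q u) (!(m / 2 ^ ℓ).bodd) + 2 ^ ℓ ∨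
      blowPos ℓ (q u) (!(m / 2 ^ ℓ).bodd) = blowPos ℓ (q v) (!(m / 2 ^ ℓ).bodd) + 2 ^ ℓ) ∧
      min (blowPos ℓ (q u) (!(m / 2 ^ ℓ).bodd)) (blowPos ℓ (q v) (!(m / 2 ^ ℓ).bodd)) / 2 ^ ℓ =
        2 * (m / 2 ^ ℓ) + 1 := by
    rcases hm with ⟨e1, e2⟩ | ⟨e1, e2⟩
    · rw [e1, e2, ha, min_eq_left (Nat.le_add_right _ _)]
      exact ⟨Or.inl rfl, hb⟩
    · rw [e1, e2, ha, min_eq_right (Nat.le_add_right _ _)]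
      exact ⟨Or.inr rfl, hb⟩
  refine ⟨!(m / 2 ^ ℓ).bodd, ?_⟩
  by_cases hs : p u / 2 ^ ℓ = p v / 2 ^ ℓ
  · refine ⟨?_, hq.1, h3, Or.inl ?_⟩
    · rw [h1] at hs
      simp only [h1]
      exact blowPos_succ_of_div_eq hs _
    · simp only [blowPos_div, hs]
  · have hmu := h4.resolve_left hs
    rw [h1] at hs
    refine ⟨?_, hq.1, h3, Or.inr ?_⟩
    · simp only [h1, hmu]
      exact blowPos_succ_of_div_ne hs
    · refine hq.2.trans ?_
      simp only [blowPos_div, hmu]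
      cases (p u / 2 ^ ℓ).bodd <;> simp

/-- Each point becomes two points at distance `2 ^ ℓ`. -/
def blow (F : SepFamily ℓ V I) (hV : 2 ^ ℓ ∣ Fintype.card V) : SepFamily ℓ (V × Bool) I where
  pos f w := blowPos ℓ (F.pos f w.1) w.2
  col f w := F.col f w.1
  inj f := by
    rintro ⟨u, a⟩ ⟨v, b⟩ h
    obtain ⟨h1, rfl⟩ := blowPos_inj h
    exact congrArg (·, _) (F.inj f h1)
  lt f w := by
    rw [Fintype.card_prod, Fintype.card_bool]
    exact blowPos_lt hV (F.lt f w.1) w.2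
  sep f g h := (F.sep f g h).imp (fun ⟨_, _, h⟩ => let ⟨_, hb⟩ := IsWitness.blow h; ⟨_, _, hb⟩)
    (fun ⟨_, _, h⟩ => let ⟨_, hb⟩ := IsWitness.blow h; ⟨_, _, hb⟩)

/-! ### Combining two families -/

/-- A bijection of the first summand with a set of size `s`, of the second with its complement. -/
noncomputable def splitEquiv {s : ℕ} (T : {T : Finset (Fin (2 * s)) // T.card = s}) :
    Fin (2 * s) ≃ Fin s ⊕ Fin s :=
  (Equiv.sumCompl (· ∈ T.1)).symm.trans
    (Equiv.sumCongr (T.1.equivFinOfCardEq T.2) (Fintype.equivFinOfCardEq (by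
      rw [Fintype.card_subtype_compl, Fintype.card_coe, T.2, Fintype.card_fin]; omega)))

theorem exists_splitEquiv_inl_inr {s : ℕ} {T T' : {T : Finset (Fin (2 * s)) // T.card = s}}
    (h : T ≠ T') : ∃ p a b, splitEquiv T p = Sum.inl a ∧ splitEquiv T' p = Sum.inr b := by
  have hsub : ¬ T.1 ⊆ T'.1 := fun hs =>
    h (Subtype.ext (Finset.eq_of_subset_of_card_le hs (by rw [T.2, T'.2])))
  obtain ⟨p, hp, hp'⟩ := Finset.not_subset.1 hsub
  refine ⟨p, T.1.equivFinOfCardEq T.2 ⟨p, hp⟩, Fintype.equivFinOfCardEq (α := {x // x ∉ T'.1}) (by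
    rw [Fintype.card_subtype_compl, Fintype.card_coe, T'.2, Fintype.card_fin]; omega) ⟨p, hp'⟩,
    ?_, ?_⟩
  · simp [splitEquiv, Equiv.sumCompl_symm_apply_of_pos hp]
  · simp only [splitEquiv, Equiv.trans_apply, Equiv.sumCompl_symm_apply_of_neg hp',
      Equiv.sumCongr_apply, Sum.map_inr]

theorem IsWitness.shift {V : Type*} {p q : V → ℕ} {c d : V → Bool} {u v : V} {n : ℕ} (hn : 2 ^ ℓ ∣ n)
    (h : IsWitness ℓ p q c d u v) :
    IsWitness ℓ (fun w => n + p w) (fun w => n + q w) c d u v := by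
  obtain ⟨t, rfl⟩ := hn
  obtain ⟨h1, h2, h3, h4⟩ := h
  have hp := Nat.two_pow_pos ℓ
  refine ⟨by dsimp only; omega, by dsimp only; omega, h3, ?_⟩
  have hmin : ∀ a b c : ℕ, min (c + a) (c + b) = c + min a b := by omega
  simp only [hmin, Nat.mul_add_div hp]
  omega

/-- A set of half of the pairs of points of `Fin (2 * s) × Bool` is chosen. The points of these
pairs are arranged next to each other, as in `split`, after the points of the other pairs, which
are arranged as in `blow`. -/
noncomputable def combine {s : ℕ} (F : SepFamily ℓ (Fin s) I) (G : SepFamily (ℓ + 1) (Fin s) J)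
    (hs : 2 ^ (ℓ + 1) ∣ s) :
    SepFamily (ℓ + 1) (Fin (2 * s) × Bool)
      ({T : Finset (Fin (2 * s)) // T.card = s} × I × J) where
  pos f w := Sum.elim (fun a => 2 * s + F.split.pos f.2.1 (a, w.2))
    (fun a => (G.blow (by simpa using hs)).pos f.2.2 (a, w.2)) (splitEquiv f.1 w.1)
  col f w := Sum.elim (fun a => F.split.col f.2.1 (a, w.2))
    (fun a => (G.blow (by simpa using hs)).col f.2.2 (a, w.2)) (splitEquiv f.1 w.1)
  inj := by
    rintro ⟨T, f, g⟩ ⟨u, a⟩ ⟨v, b⟩ h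
    have hF := F.split.inj f
    have hG := (G.blow (by simpa using hs)).inj g
    have hlt := (G.blow (by simpa using hs)).lt g
    simp only [Fintype.card_prod, Fintype.card_fin, Fintype.card_bool] at hlt
    obtain ⟨u, rfl⟩ := (splitEquiv T).symm.surjective u
    obtain ⟨v, rfl⟩ := (splitEquiv T).symm.surjective v
    simp only [Equiv.apply_symm_apply] at h
    rcases u with u | u <;> rcases v with v | v <;> simp only [Sum.elim_inl, Sum.elim_inr] at h
    · have := hF (Nat.add_left_cancel h)
      simp_all
    · have := hlt (v, b); omega
    · have := hlt (u, a); omega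
    · have := hG h
      simp_all
  lt := by
    rintro ⟨T, f, g⟩ ⟨u, a⟩
    have hF := F.split.lt f
    have hG := (G.blow (by simpa using hs)).lt g
    simp only [Fintype.card_prod, Fintype.card_fin, Fintype.card_bool] at hF hG ⊢
    obtain ⟨u, rfl⟩ := (splitEquiv T).symm.surjective u
    simp only [Equiv.apply_symm_apply]
    rcases u with u | u <;> simp only [Sum.elim_inl, Sum.elim_inr]
    · have := hF (u, a); omega
    · have := hG (u, a); omega
  sep := by
    rintro ⟨T, f, g⟩ ⟨T', f', g'⟩ hne
    by_cases hT : T = T'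
    · subst hT
      by_cases hf : f = f'
      · subst hf
        have hg : g ≠ g' := fun hg => hne (by rw [hg])
        refine ((G.blow (by simpa using hs)).sep g g' hg).imp ?_ ?_ <;>
        · rintro ⟨u, v, h⟩
          refine ⟨((splitEquiv T).symm (Sum.inr u.1), u.2),
            ((splitEquiv T).symm (Sum.inr v.1), v.2), ?_⟩
          simpa only [IsWitness, Equiv.apply_symm_apply, Sum.elim_inr] using h
      · refine (F.split.sep f f' hf).imp ?_ ?_ <;>
        · rintro ⟨u, v, h⟩
          refine ⟨((splitEquiv T).symm (Sum.inl u.1), u.2),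
            ((splitEquiv T).symm (Sum.inl v.1), v.2), ?_⟩
          simpa only [IsWitness, Equiv.apply_symm_apply, Sum.elim_inl] using
            IsWitness.shift (n := 2 * s) (hs.mul_left 2) h
    · left
      obtain ⟨p, a, b, ha, hb⟩ := exists_splitEquiv_inl_inr hT
      -- The pair `p` is split for `T`, so its points are adjacent, in one block, and of different
      -- colours; for `T'` it is blown up, so they are `2 ^ (ℓ + 1)` apart with equal colours.
      refine ⟨(p, F.col f a), (p, !F.col f a), ?_, ?_, ?_, Or.inl ?_⟩
      · simp [ha, split, add_assoc]
      · simp only [hb, Sum.elim_inr, blow]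
        have := blowPos_true_false (ℓ + 1) (G.pos g' b)
        cases F.col f a
        · exact this
        · exact this.symm
      · simp [ha, hb, split, blow]
      · obtain ⟨t, ht⟩ := hs.mul_left 2
        simp only [ha, Sum.elim_inl, split, ht, Nat.mul_add_div (Nat.two_pow_pos (ℓ + 1)),
          two_mul_add_div]

end SepFamily

/-! ### Cycles in unions of paths and the upper bound -/

namespace SimpleGraph

variable {V : Type*}

theorem exists_walk_of_adj_succ {G : SimpleGraph V} (w : ℕ → V) (m : ℕ)
    (h : ∀ i < m, G.Adj (w i) (w (i + 1))) :
    ∃ p : G.Walk (w 0) (w m), p.support = (List.range (m + 1)).map w ∧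
      p.edges = (List.range m).map fun i => s(w i, w (i + 1)) := by
  induction m with
  | zero => exact ⟨.nil, by simp, by simp⟩
  | succ m ih =>
    obtain ⟨p, hs, he⟩ := ih fun i hi => h i (hi.trans m.lt_succ_self)
    refine ⟨p.concat (h m m.lt_succ_self), ?_, ?_⟩
    · rw [Walk.support_concat, hs, List.range_succ (n := m + 1), List.map_append]
      simp
    · rw [Walk.edges_concat, he, List.range_succ, List.map_append]
      simp

theorem containsCycle_of_adj_succ {G : SimpleGraph V} (w : ℕ → V) {m : ℕ} (hm : 2 ≤ m)
    (hw : Set.InjOn w (Set.Iic m)) (h : ∀ i < m, G.Adj (w i) (w (i + 1)))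
    (h0 : G.Adj (w m) (w 0)) : ContainsCycle G (m + 1) := by
  obtain ⟨p, hs, he⟩ := exists_walk_of_adj_succ w m h
  refine ⟨w m, Walk.cons h0 p, ?_, ?_⟩
  · rw [Walk.cons_isCycle_iff, Walk.isPath_def, hs, he]
    constructor
    · refine List.Nodup.map_on (fun x hx y hy hxy => hw ?_ ?_ hxy) List.nodup_range
      · exact Nat.lt_succ_iff.1 (List.mem_range.1 hx)
      · exact Nat.lt_succ_iff.1 (List.mem_range.1 hy)
    · rw [List.mem_map]
      rintro ⟨i, hi, heq⟩
      have hi := List.mem_range.1 hi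
      rcases Sym2.eq_iff.1 heq with ⟨h1, -⟩ | ⟨h1, h2⟩
      · exact hi.ne (hw hi.le (show m ≤ m from le_rfl) h1)
      · have e1 := hw hi.le (Nat.zero_le m) h1
        have e2 := hw (show i + 1 ≤ m from hi) (show m ≤ m from le_rfl) h2
        omega
  · have := congrArg List.length he
    simpa using this

/-- The path along which the position `p` increases. -/
def ofPos (p : V → ℕ) : SimpleGraph V where
  Adj u v := p u + 1 = p v ∨ p v + 1 = p u
  symm := ⟨fun _ _ h => h.symm⟩
  loopless := ⟨fun _ h => by omega⟩

theorem isHamPath_ofPos {n : ℕ} {p : Fin n → ℕ} (hp : Function.Injective p) (hn : ∀ v, p v < n) :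
    IsHamPath (ofPos p) := by
  let e : Fin n ≃ Fin n := Equiv.ofBijective (fun v => ⟨p v, hn v⟩)
    (Finite.injective_iff_bijective.1 fun u v h => hp (by simpa using h))
  refine ⟨(⟨e, ?_⟩ : ofPos p ≃g pathGraph n).symm⟩
  intro u v
  exact pathGraph_adj

/-- The segment of the second path between `u` and `v` has `k` edges, and the edge of the first path
closes it. -/
theorem containsCycle_ofPos_sup {n k : ℕ} (hk : 2 ≤ k) {p q : Fin n → ℕ}
    (hq : Function.Injective q) (hn : ∀ v, q v < n) {u v : Fin n} (hp : (ofPos p).Adj u v)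
    (h : q v = q u + k ∨ q u = q v + k) : ContainsCycle (ofPos p ⊔ ofPos q) (k + 1) := by
  wlog huv : q v = q u + k generalizing u v
  · exact this hp.symm h.symm (h.resolve_left huv)
  have hsurj : ∀ i < n, ∃ x, q x = i := by
    have hb : Function.Bijective (fun v => (⟨q v, hn v⟩ : Fin n)) :=
      Finite.injective_iff_bijective.1 fun u v h => hq (by simpa using h)
    intro i hi
    obtain ⟨x, hx⟩ := hb.2 ⟨i, hi⟩
    exact ⟨x, congrArg Fin.val hx⟩
  have hex : ∀ i ≤ k, ∃ x, q x = q u + i := fun i hi => hsurj _ (by have := hn v; omega)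
  have : Nonempty (Fin n) := ⟨u⟩
  choose! w hw using hex
  have hwu : w 0 = u := hq (by simpa using hw 0 (Nat.zero_le k))
  have hwv : w k = v := hq (by rw [hw k le_rfl, huv])
  refine containsCycle_of_adj_succ w hk ?_ ?_ (Or.inl (by rw [hwu, hwv]; exact hp.symm))
  · intro i hi j hj hij
    have := hw i hi
    rw [hij, hw j hj] at this
    omega
  · intro i hi
    exact Or.inr (Or.inl (by rw [hw i hi.le, hw (i + 1) hi]; rfl))

theorem IsHamPath.nonempty_coloring {n : ℕ} {H : SimpleGraph (Fin n)} (h : IsHamPath H) :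
    Nonempty (H.Coloring Bool) :=
  h.map fun e => (pathGraph.bicoloring n).comp e.symm.toHom

theorem card_le_two_pow_of_isCycleDifferentFamily {n k : ℕ} (hk : Odd k)
    {F : Finset (SimpleGraph (Fin n))} (hF : IsCycleDifferentFamily n k F) : F.card ≤ 2 ^ n := by
  let c := fun H : F => (IsHamPath.nonempty_coloring (hF.1 H H.2)).some
  have hinj : Function.Injective fun (H : F) (v : Fin n) => c H v := by
    intro H₁ H₂ h
    by_contra hne
    obtain ⟨v, p, -, hp⟩ := hF.2 H₁ H₁.2 H₂ H₂.2 (fun h => hne (Subtype.ext h))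
    let d : (H₁.1 ⊔ H₂.1).Coloring Bool := Coloring.mk (c H₁) (by
      rintro u v (huv | huv)
      · exact (c H₁).valid huv
      · have := (c H₂).valid huv
        rwa [← show c H₁ u = c H₂ u from congrFun h u,
          ← show c H₁ v = c H₂ v from congrFun h v] at this)
    have := (d.odd_length_iff_not_congr p).1 (hp ▸ hk)
    tauto
  simpa using Fintype.card_le_of_injective _ hinj

end SimpleGraph

/-! ### Sizes of the families -/

namespace SepFamily

theorem exists_isCycleDifferentFamily {ℓ n g : ℕ} (hℓ : 1 ≤ ℓ) (F : SepFamily ℓ (Fin n) (Fin g)) :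
    ∃ S, IsCycleDifferentFamily n (2 ^ ℓ + 1) S ∧ S.card = g := by
  classical
  have hk : 2 ≤ 2 ^ ℓ := Nat.le_self_pow (by omega) 2
  have hlt : ∀ f v, F.pos f v < n := fun f v => by simpa using F.lt f v
  have hne : ∀ f f' u v, IsWitness ℓ (F.pos f) (F.pos f') (F.col f) (F.col f') u v →
      SimpleGraph.ofPos (F.pos f) ≠ SimpleGraph.ofPos (F.pos f') := by
    -- Points at distance `2 ^ ℓ ≥ 2` are not adjacent, so the two paths differ.
    rintro f f' u v ⟨h1, h2, -⟩ heq
    have : (SimpleGraph.ofPos (F.pos f)).Adj u v := Or.inl h1.symm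
    rw [heq] at this
    simp only [SimpleGraph.ofPos] at this
    omega
  have hinj : Function.Injective fun f => SimpleGraph.ofPos (F.pos f) := by
    intro f f' heq
    by_contra h
    rcases F.sep f f' h with ⟨u, v, h⟩ | ⟨u, v, h⟩
    · exact hne _ _ u v h heq
    · exact hne _ _ u v h heq.symm
  refine ⟨Finset.univ.image fun f => SimpleGraph.ofPos (F.pos f), ⟨?_, ?_⟩, ?_⟩
  · intro H hH
    obtain ⟨f, -, rfl⟩ := Finset.mem_image.1 hH
    exact SimpleGraph.isHamPath_ofPos (F.inj f) (hlt f)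
  · intro H hH H' hH' h
    obtain ⟨f, -, rfl⟩ := Finset.mem_image.1 hH
    obtain ⟨f', -, rfl⟩ := Finset.mem_image.1 hH'
    rcases F.sep f f' (fun hf => h (by rw [hf])) with ⟨u, v, h1, h2, -⟩ | ⟨u, v, h1, h2, -⟩
    · exact SimpleGraph.containsCycle_ofPos_sup hk (F.inj _) (hlt _) (Or.inl h1.symm) h2
    · rw [sup_comm]
      exact SimpleGraph.containsCycle_ofPos_sup hk (F.inj _) (hlt _) (Or.inl h1.symm) h2
  · rw [Finset.card_image_of_injective _ hinj, Finset.card_univ, Fintype.card_fin]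

/-- Families with `g > 0` members exist on `n` points. -/
def Attains (ℓ n g : ℕ) : Prop :=
  0 < g ∧ Nonempty (SepFamily ℓ (Fin n) (Fin g))

theorem attains_of_card {ℓ n g : ℕ} {V I : Type*} [Fintype V] [Fintype I] (F : SepFamily ℓ V I)
    (hV : Fintype.card V = n) (hI : Fintype.card I = g) (hg : 0 < g) : Attains ℓ n g :=
  ⟨hg, ⟨F.transport (Fintype.equivFinOfCardEq hV).symm (Fintype.equivFinOfCardEq hI).symm⟩⟩

theorem attains_one (ℓ n : ℕ) : Attains ℓ n 1 :=
  attains_of_card (single ℓ n) (by simp) (by simp) one_pos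

theorem attains_natural (n : ℕ) : Attains 0 (n + 1) (2 ^ n) :=
  attains_of_card (natural n) (by simp) (by simp) (Nat.two_pow_pos n)

theorem Attains.mono {ℓ n m g : ℕ} (h : Attains ℓ n g) (hnm : n ≤ m) : Attains ℓ m g := by
  induction m, hnm using Nat.le_induction with
  | base => exact h
  | succ m _ ih =>
    obtain ⟨hg, ⟨F⟩⟩ := ih
    exact attains_of_card F.pad (by simp) (by simp) hg

theorem Attains.combine {ℓ s g h : ℕ} (hs : 2 ^ (ℓ + 1) ∣ s) (hg : Attains ℓ s g)
    (hh : Attains (ℓ + 1) s h) : Attains (ℓ + 1) (4 * s) (s.centralBinom * (g * h)) := by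
  obtain ⟨hg, ⟨F⟩⟩ := hg
  obtain ⟨hh, ⟨G⟩⟩ := hh
  refine attains_of_card (F.combine G hs) (by simp; omega) ?_
    (Nat.mul_pos s.centralBinom_pos (Nat.mul_pos hg hh))
  simp [Fintype.card_finset_len, Nat.centralBinom]

theorem two_mul_sub_le_logb_centralBinom {s : ℕ} (hs : 0 < s) :
    2 * (s : ℝ) - Real.logb 2 (2 * s) ≤ Real.logb 2 s.centralBinom := by
  have hc : (0 : ℝ) < s.centralBinom := by exact_mod_cast s.centralBinom_pos
  have hs' : (0 : ℝ) < s := by exact_mod_cast hs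
  have h : ((4 : ℝ) ^ s) ≤ 2 * s * s.centralBinom := by
    exact_mod_cast Nat.four_pow_le_two_mul_self_mul_centralBinom s hs
  have h2 := Real.logb_le_logb_of_le (b := 2) (by norm_num) (by positivity) h
  rw [Real.logb_mul (by positivity) hc.ne', show (4 : ℝ) = 2 ^ 2 by norm_num, ← pow_mul,
    Real.logb_pow, Real.logb_self_eq_one (by norm_num)] at h2
  push_cast at h2
  linarith

theorem eventually_logb_two_mul_add_le {δ : ℝ} (hδ : 0 < δ) (C : ℝ) :
    ∃ s₀ : ℕ, ∀ s ≥ s₀, Real.logb 2 (2 * s) + C ≤ 2 * δ * s := by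
  have hl : (fun s : ℕ => Real.log (2 * s)) =o[atTop] fun s : ℕ => (2 * s : ℝ) :=
    Real.isLittleO_log_id_atTop.comp_tendsto
      (tendsto_natCast_atTop_atTop.const_mul_atTop (by norm_num : (0 : ℝ) < 2))
  have h2 : 0 < Real.log 2 := Real.log_pos (by norm_num)
  have hC : Tendsto (fun s : ℕ => δ * s) atTop atTop :=
    tendsto_natCast_atTop_atTop.const_mul_atTop hδ
  have hb := hl.bound (c := δ / 2 * Real.log 2) (by positivity)
  refine eventually_atTop.1 ?_
  filter_upwards [hb, hC.eventually_ge_atTop C] with s h3 h4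
  have h5 : Real.logb 2 (2 * s) ≤ δ * s := by
    rw [Real.logb, div_le_iff₀ h2]
    refine (le_abs_self _).trans (h3.trans_eq ?_)
    rw [Real.norm_of_nonneg (by positivity)]
    ring
  linarith

/-- In the recursion from `s` to `4 * s` the two smaller families lose only `2 * δ * s` of the
allowed `4 * δ * s`; the rest absorbs the logarithmic loss in the binomial coefficient, the constant
of level `ℓ` and the rounding. -/
theorem exists_attains (ℓ : ℕ) {δ : ℝ} (hδ : 0 < δ) :
    ∃ C : ℝ, ∀ n : ℕ, ∃ g, Attains ℓ n g ∧ (1 - δ) * n - C ≤ Real.logb 2 g := by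
  induction ℓ with
  | zero =>
    refine ⟨1, fun n => ?_⟩
    cases n with
    | zero => exact ⟨1, attains_one 0 0, by simp⟩
    | succ n =>
      refine ⟨2 ^ n, attains_natural n, ?_⟩
      have : (0 : ℝ) ≤ n := n.cast_nonneg
      push_cast
      rw [Real.logb_pow, Real.logb_self_eq_one (by norm_num)]
      nlinarith
  | succ ℓ ih =>
    obtain ⟨C', hC'⟩ := ih
    set R := 2 ^ (ℓ + 1) with hR
    have hRpos : 0 < R := Nat.two_pow_pos _
    obtain ⟨s₀, hs₀⟩ := eventually_logb_two_mul_add_le hδ (C' + 4 * R)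
    -- If `s < s₀ + R`, then `n ≤ 4 * s + 4 * R` is at most this constant, and one member suffices.
    refine ⟨4 * s₀ + 8 * R, fun n => ?_⟩
    induction n using Nat.strong_induction_on with
    | _ n IH =>
    set s := R * (n / (4 * R)) with hs
    have h1 : 4 * s ≤ n := by
      have := Nat.mul_div_le n (4 * R)
      rw [hs]; linarith
    have h2 : n ≤ 4 * s + 4 * R := by
      have := Nat.lt_mul_div_succ n (show 0 < 4 * R by omega)
      rw [hs]; linarith
    have h1' : 4 * (s : ℝ) ≤ n := by exact_mod_cast h1
    have h2' : (n : ℝ) ≤ 4 * s + 4 * R := by exact_mod_cast h2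
    by_cases hss : s < s₀ + R
    · refine ⟨1, attains_one _ _, ?_⟩
      have h3 : (s : ℝ) ≤ s₀ + R := by exact_mod_cast hss.le
      have : (0 : ℝ) ≤ n := n.cast_nonneg
      simp only [Nat.cast_one, Real.logb_one]
      nlinarith
    · have hspos : 0 < s := by omega
      obtain ⟨g, hg, hg'⟩ := hC' s
      obtain ⟨h, hh, hh'⟩ := IH s (by omega)
      refine ⟨_, (hg.combine ⟨_, hs⟩ hh).mono h1, ?_⟩
      have hc : (s.centralBinom : ℝ) ≠ 0 := by exact_mod_cast s.centralBinom_ne_zero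
      have e1 : (g : ℝ) ≠ 0 := by exact_mod_cast hg.1.ne'
      have e2 : (h : ℝ) ≠ 0 := by exact_mod_cast hh.1.ne'
      push_cast
      rw [Real.logb_mul hc (mul_ne_zero e1 e2), Real.logb_mul e1 e2]
      have h3 := two_mul_sub_le_logb_centralBinom hspos
      have h4 := hs₀ s (by omega)
      have h5 : 0 ≤ δ * ((n : ℝ) - 4 * s) := mul_nonneg hδ.le (by linarith)
      linarith

end SepFamily

/-! ### The maximum and its asymptotics -/

theorem exists_isGreatest_card_isCycleDifferentFamily {n k : ℕ} (hk : Odd k) :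
    ∃ m, IsGreatest {m : ℕ | ∃ F : Finset (SimpleGraph (Fin n)),
      IsCycleDifferentFamily n k F ∧ F.card = m} m := by
  have hbdd : BddAbove {m : ℕ | ∃ F : Finset (SimpleGraph (Fin n)),
      IsCycleDifferentFamily n k F ∧ F.card = m} := by
    refine ⟨2 ^ n, ?_⟩
    rintro m ⟨F, hF, rfl⟩
    exact SimpleGraph.card_le_two_pow_of_isCycleDifferentFamily hk hF
  exact ⟨_, Nat.sSup_mem ⟨0, ∅, by simp [IsCycleDifferentFamily], rfl⟩ hbdd,
    fun m hm => le_csSup hbdd hm⟩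

theorem mainTheorem2 (ℓ : ℕ) (hℓ : 1 ≤ ℓ) :
    ∃ (M : ℕ → ℕ) (ε : ℕ → ℝ),
      (∀ n : ℕ, IsGreatest
        {m : ℕ | ∃ F : Finset (SimpleGraph (Fin n)),
          IsCycleDifferentFamily n (2 ^ ℓ + 1) F ∧ F.card = m} (M n)) ∧
      ε =o[atTop] (fun n : ℕ => (n : ℝ)) ∧
      ∀ n : ℕ, (M n : ℝ) = (2 : ℝ) ^ ((n : ℝ) - ε n) := by
  have hodd : Odd (2 ^ ℓ + 1) := (Nat.even_pow.2 ⟨even_two, by omega⟩).add_one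
  choose M hM using fun n => exists_isGreatest_card_isCycleDifferentFamily (n := n) hodd
  have hle : ∀ n g, SepFamily.Attains ℓ n g → g ≤ M n := fun n g h =>
    let ⟨F⟩ := h.2
    (hM n).2 (SepFamily.exists_isCycleDifferentFamily hℓ F)
  have hpos : ∀ n, (0 : ℝ) < M n := fun n => by
    exact_mod_cast hle n 1 (SepFamily.attains_one ℓ n)
  refine ⟨M, fun n => n - Real.logb 2 (M n), hM, ?_, fun n => ?_⟩
  · rw [isLittleO_iff]
    intro δ hδ
    obtain ⟨C, hC⟩ := SepFamily.exists_attains ℓ (half_pos hδ)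
    have hT : Tendsto (fun n : ℕ => δ / 2 * n) atTop atTop :=
      tendsto_natCast_atTop_atTop.const_mul_atTop (half_pos hδ)
    filter_upwards [hT.eventually_ge_atTop C] with n hn
    obtain ⟨g, hg, hg'⟩ := hC n
    have h1 : Real.logb 2 g ≤ Real.logb 2 (M n) :=
      Real.logb_le_logb_of_le (by norm_num) (by exact_mod_cast hg.1) (by exact_mod_cast hle n g hg)
    have h2 : Real.logb 2 (M n) ≤ n := by
      obtain ⟨F, hF, hFM⟩ := (hM n).1
      rw [Real.logb_le_iff_le_rpow (by norm_num) (hpos n), Real.rpow_natCast, ← hFM]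
      exact_mod_cast SimpleGraph.card_le_two_pow_of_isCycleDifferentFamily hodd hF
    rw [Real.norm_of_nonneg (by linarith), Real.norm_of_nonneg n.cast_nonneg]
    linarith
  · rw [sub_sub_cancel, Real.rpow_logb (by norm_num) (by norm_num) (hpos n)]
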